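/- For $s\in\mathbb R$ let $J^s=(1-\partial_x^2)^{s/2}$ be the Fourier multiplier with symbol $(1+4\pi^2\xi^2)^{s/2}$. For $s\ge 0$ let $H^s(\mathbb R)$ be the space of real-valued $f\in L^2(\mathbb R)$ with $J^sf\in L^2(\mathbb R)$, with norm $\|f\|_{H^s(\mathbb R)}=\|J^sf\|_{L^2}$. For an open set $\Omega\subseteq\mathbb R$, $H^s(\Omega)$ is the space of functions $f:\Omega\to\mathbb R$ for which there is $F\in H^s(\mathbb R)$ with $F|_\Omega=f$ (almost everywhere), and $\|f\|_{H^s(\Omega)}$ is the infimum of $\|F\|_{H^s(\mathbb R)}$ over all such $F$. Let $s\ge 0$, $u_0\in H^s(\mathbb R)$, and let $\Omega\subseteq\mathbb R$ be open. Let $u\in C(\mathbb R:H^s(\mathbb R))$ be the solution of the initial value problem for the Benjamin–Bona–Mahony equation $$\partial_t u+(1-\partial_x^2)^{-1}(\partial_x u+u\,\partial_x u)=0,\qquad u(\cdot,0)=u_0,$$ where $u\,\partial_xu=\partial_x(u^2/2)$ and the equation holds, for every $t\in\mathbb R$, in the sense of tempered distributions in $x$. (a) If $s\le 1/2$, $\eta\in(0,s+1/2)$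 and $u_0|_\Omega\in H^{s+\eta}(\Omega)$, then $u|_\Omega\in C(\mathbb R:H^{s+\eta}(\Omega))$. (b) If $s\le 1/2$, $\eta\in(0,s+1/2)$ and $u_0|_\Omega\notin H^{s+\eta}(\Omega)$, then $u(t)|_\Omega\notin H^{s+\eta}(\Omega)$ for every $t\in\mathbb R$. (c) If $s>1/2$, $\eta\in(0,1]$ and $u_0|_\Omega\in H^{s+\eta}(\Omega)$, then $u|_\Omega\in C(\mathbb R:H^{s+\eta}(\Omega))$. (d) If $s>1/2$, $\eta\in(0,1]$ and $u_0|_\Omega\notin H^{s+\eta}(\Omega)$, then $u(t)|_\Omega\notin H^{s+\eta}(\Omega)$ for every $t\in\mathbb R$. -/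

import Mathlib

open MeasureTheory Filter Topology
open scoped SchwartzMap ENNReal

noncomputable section

namespace BBM

/-- The symbol `(1 + 4π²ξ²)^{s/2}` of the Bessel potential `J^s = (1 - ∂ₓ²)^{s/2}`, for the
Fourier transform `f̂(ξ) = ∫ f(x) e^{-2πixξ} dx`. -/
def besselSymbol (s : ℝ) (ξ : ℝ) : ℂ :=
  (((1 + 4 * Real.pi ^ 2 * ξ ^ 2) ^ (s / 2) : ℝ) : ℂ)

/-- The symbol is smooth with all derivatives of polynomial growth, so it is a legitimate
Fourier multiplier on tempered distributions. -/
theorem hasTemperateGrowth_besselSymbol (s : ℝ) :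
    (besselSymbol s).HasTemperateGrowth := by
  have h1 := Function.hasTemperateGrowth_one_add_norm_sq_rpow ℝ (s / 2)
  have h2 : Function.HasTemperateGrowth (fun ξ : ℝ => (2 * Real.pi) * ξ) := by fun_prop
  have h3 : besselSymbol s = Complex.ofReal ∘
      (fun x : ℝ => (1 + ‖x‖ ^ 2) ^ (s / 2)) ∘ fun ξ : ℝ => (2 * Real.pi) * ξ := by
    funext ξ
    simp only [besselSymbol, Function.comp_apply, Real.norm_eq_abs, sq_abs]
    congr 3
    ring
  rw [h3]
  exact Function.Complex.hasTemperateGrowth_ofReal.comp (h1.comp h2)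

/-- The Bessel potential `J^s = (1 - ∂ₓ²)^{s/2}` on tempered distributions. In particular
`bessel (-2)` is `(1 - ∂ₓ²)⁻¹`. -/
def bessel (s : ℝ) : 𝓢'(ℝ, ℂ) →L[ℂ] 𝓢'(ℝ, ℂ) :=
  TemperedDistribution.fourierMultiplierCLM ℂ (besselSymbol s)

/-- A real-valued `L²` function as a tempered distribution. -/
def toDist (f : Lp ℝ 2 (volume : Measure ℝ)) : 𝓢'(ℝ, ℂ) :=
  ((Complex.ofRealCLM.compLp f : Lp ℂ 2 (volume : Measure ℝ)) : 𝓢'(ℝ, ℂ))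

/-- The square of a real-valued `L²` function, which is an `L¹` function, as a tempered
distribution. -/
def sqDist (f : Lp ℝ 2 (volume : Measure ℝ)) : 𝓢'(ℝ, ℂ) :=
  (((Lp.memLp f).integrable_sq.ofReal.toL1 (fun x => (((f x) ^ 2 : ℝ) : ℂ)) :
    Lp ℂ 1 (volume : Measure ℝ)) : 𝓢'(ℝ, ℂ))

/-- `f ∈ H^s(ℝ) = J^{-s} L²(ℝ)`, for a real-valued `f ∈ L²(ℝ)`. As `H^s(ℝ) ⊆ L²(ℝ)` for `s ≥ 0`,
this describes the whole of the real space `H^s(ℝ)` when `s ≥ 0`. -/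
def MemHs (s : ℝ) (f : Lp ℝ 2 (volume : Measure ℝ)) : Prop :=
  ∃ g : Lp ℂ 2 (volume : Measure ℝ), bessel s (toDist f) = (g : 𝓢'(ℝ, ℂ))

/-- The norm `‖f‖_{H^s(ℝ)} = ‖J^s f‖_{L²}`, with value `∞` if `f ∉ H^s(ℝ)`. (At most one `g` enters
the infimum, and none does if `f ∉ H^s(ℝ)`.) -/
def hsNorm (s : ℝ) (f : Lp ℝ 2 (volume : Measure ℝ)) : ℝ≥0∞ :=
  ⨅ (g : Lp ℂ 2 (volume : Measure ℝ)) (_ : bessel s (toDist f) = (g : 𝓢'(ℝ, ℂ))), ‖g‖ₑ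

/-- `v ∈ C(ℝ : H^s(ℝ))`. -/
def ContinuousIntoHs (s : ℝ) (v : ℝ → Lp ℝ 2 (volume : Measure ℝ)) : Prop :=
  (∀ t, MemHs s (v t)) ∧
    ∀ t₀, Tendsto (fun t => hsNorm s (v t - v t₀)) (𝓝 t₀) (𝓝 0)

/-- `f|_Ω ∈ H^r(Ω)`, `r ≥ 0`: there is `F ∈ H^r(ℝ)` with `F|_Ω = f|_Ω`. Only the values of `f` on
`Ω` enter. -/
def MemHsOn (r : ℝ) (Ω : Set ℝ) (f : ℝ → ℝ) : Prop :=
  ∃ F : Lp ℝ 2 (volume : Measure ℝ), MemHs r F ∧ F =ᵐ[volume.restrict Ω] f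

/-- The norm of `f|_Ω` in `H^r(Ω)`: the infimum of the `H^r(ℝ)` norms of all extensions
(`∞` if there are none in `H^r(ℝ)`). -/
def hsOnNorm (r : ℝ) (Ω : Set ℝ) (f : ℝ → ℝ) : ℝ≥0∞ :=
  ⨅ (F : Lp ℝ 2 (volume : Measure ℝ)) (_ : F =ᵐ[volume.restrict Ω] f), hsNorm r F

/-- `v|_Ω ∈ C(ℝ : H^r(Ω))`. -/
def ContinuousIntoHsOn (r : ℝ) (Ω : Set ℝ) (v : ℝ → ℝ → ℝ) : Prop :=
  (∀ t, MemHsOn r Ω (v t)) ∧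
    ∀ t₀, Tendsto (fun t => hsOnNorm r Ω (v t - v t₀)) (𝓝 t₀) (𝓝 0)

/-- `u` solves the initial value problem
`∂ₜ u + (1 - ∂ₓ²)⁻¹ (∂ₓ u + u ∂ₓ u) = 0`, `u(0) = u₀`,
in the sense of tempered distributions in `x` for every `t`; as usual `u ∂ₓ u = ∂ₓ (u² / 2)`. -/
structure SolvesBBM (u₀ : Lp ℝ 2 (volume : Measure ℝ))
    (u : ℝ → Lp ℝ 2 (volume : Measure ℝ)) : Prop where
  initial : u 0 = u₀
  equation : ∀ (t : ℝ) (φ : 𝓢(ℝ, ℂ)),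
    HasDerivAt (fun τ => toDist (u τ) φ)
      (-(bessel (-2) (TemperedDistribution.derivCLM ℂ
        (toDist (u t) + (1 / 2 : ℂ) • sqDist (u t))) φ)) t

end BBM

end

/-!
A solution of the BBM equation differs from its initial value by a function that is smoother by `η`
derivatives, on the whole line. So membership in `H^{s+η}(Ω)` is the same for `u₀` and for `u(t)`,
whatever the set `Ω` is, and the continuity of `u|_Ω` is the continuity of the increments
`u(t) - u(t')` in `H^{s+η}(ℝ)` (`memHsOn_propagation`).

The time derivative of `u` is `-∂ₓ (1 - ∂ₓ²)⁻¹ (u + u²/2)`, and `∂ₓ (1 - ∂ₓ²)⁻¹` gains one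
derivative, so everything rests on the product estimate `H^s · H^s ⊆ H^r` with `r = s + η - 1`. It
holds whenever `0 ≤ s`, `r ≤ s` and `r < 2s - 1/2`, a condition that covers both ranges of `s` and
`η` in the theorem. On the Fourier side the estimate is the boundedness on `L² × L² × L²` of a
trilinear convolution form with kernel `⟨ξ⟩^r ⟨t⟩^{-s} ⟨ξ - t⟩^{-s}`, where
`⟨ξ⟩ = (1 + 4π²ξ²)^{1/2}`. As the larger of `⟨t⟩` and `⟨ξ - t⟩` dominates `⟨ξ⟩`, this kernel is at
most a constant times `⟨ξ⟩^{-m} + ⟨t⟩^{-m} + ⟨ξ - t⟩^{-m}` with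
`m = 2s - r > 1/2` (`kernel_le`). Each summand is a square integrable function of one frequency, and
two applications of the Cauchy–Schwarz inequality finish the estimate (`trilinear_weighted_le`).

Estimates are kept in dual form: a tempered distribution `T` with `|T φ| ≤ M ‖φ‖_{L²}` for all
Schwartz functions `φ` is an `L²` function of norm at most `M` (`exists_eq_toTemperedDistribution`).
Therefore the product estimate is needed only against Schwartz functions, and the equation, which is
posed in the weak sense, is integrated in time by the mean value inequality for the scalar functions
`t ↦ ⟨u(t), J^{s+η} φ⟩` (`exists_bessel_sub_eq`).
-/

noncomputable section

namespace BBM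

/-! ### The Japanese bracket and the frequency kernel -/

/-- The square `1 + 4π²ξ²` of the Japanese bracket of the frequency `ξ`. Powers of the bracket are
written as powers of its square, with half the exponent. -/
def bracketSq (ξ : ℝ) : ℝ := 1 + 4 * Real.pi ^ 2 * ξ ^ 2

lemma one_le_bracketSq (ξ : ℝ) : 1 ≤ bracketSq ξ :=
  le_add_of_nonneg_right (by positivity)

lemma bracketSq_pos (ξ : ℝ) : 0 < bracketSq ξ := one_pos.trans_le (one_le_bracketSq ξ)

lemma bracketSq_add_le (a b : ℝ) :
    bracketSq (a + b) ≤ 4 * max (bracketSq a) (bracketSq b) := by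
  have h : bracketSq (a + b) ≤ 2 * bracketSq a + 2 * bracketSq b := by
    have : 0 ≤ 4 * Real.pi ^ 2 * (a - b) ^ 2 := by positivity
    unfold bracketSq
    nlinarith
  linarith [le_max_left (bracketSq a) (bracketSq b), le_max_right (bracketSq a) (bracketSq b)]

lemma continuous_bracketSq : Continuous bracketSq := by unfold bracketSq; fun_prop

lemma norm_besselSymbol (s ξ : ℝ) : ‖besselSymbol s ξ‖ = bracketSq ξ ^ (s / 2) := by
  rw [besselSymbol, Complex.norm_real, Real.norm_of_nonneg]
  · rfl
  · exact Real.rpow_nonneg (bracketSq_pos ξ).le _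

/-- The case `y ≤ z` of `kernel_le`. -/
lemma kernel_le_of_le {x y z σ ρ : ℝ} (hx : 1 ≤ x) (hy : 1 ≤ y) (hσ : 0 ≤ σ) (hρ : ρ ≤ σ)
    (hyz : y ≤ z) (hxz : x ≤ 4 * z) :
    x ^ ρ * (y ^ (-σ) * z ^ (-σ)) ≤ 4 ^ σ * (x ^ (ρ - 2 * σ) + y ^ (ρ - 2 * σ)) := by
  have hx0 : 0 < x := by linarith
  have hy0 : 0 < y := by linarith
  have hz0 : 0 < z := by linarith
  have h4 : (1 : ℝ) ≤ 4 ^ σ := Real.one_le_rpow (by norm_num) hσ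
  have px := Real.rpow_pos_of_pos hx0 (ρ - 2 * σ)
  have py := Real.rpow_pos_of_pos hy0 (ρ - 2 * σ)
  rcases le_total x y with hxy | hyx
  -- `x` is the smallest of the three, and `y`, `z` occur with nonpositive exponents
  · have e1 : y ^ (-σ) ≤ x ^ (-σ) := Real.rpow_le_rpow_of_nonpos hx0 hxy (by linarith)
    have e2 : z ^ (-σ) ≤ x ^ (-σ) := Real.rpow_le_rpow_of_nonpos hx0 (hxy.trans hyz) (by linarith)
    calc x ^ ρ * (y ^ (-σ) * z ^ (-σ)) ≤ x ^ ρ * (x ^ (-σ) * x ^ (-σ)) := by gcongr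
      _ = x ^ (ρ - 2 * σ) := by
        rw [← Real.rpow_add hx0, ← Real.rpow_add hx0]; congr 1; ring
      _ ≤ 1 * (x ^ (ρ - 2 * σ) + y ^ (ρ - 2 * σ)) := by linarith
      _ ≤ _ := by gcongr
  -- `z` dominates `x`, so that the kernel is at most a multiple of `x ^ (ρ - σ) * y ^ (-σ)`
  · have e1 : z ^ (-σ) ≤ 4 ^ σ * x ^ (-σ) := by
      have : z ^ (-σ) ≤ (x / 4) ^ (-σ) :=
        Real.rpow_le_rpow_of_nonpos (by positivity) (by linarith) (by linarith)
      rwa [Real.div_rpow hx0.le (by norm_num), Real.rpow_neg (by norm_num : (0 : ℝ) ≤ 4),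
        div_inv_eq_mul, mul_comm] at this
    have e2 : x ^ (ρ - σ) ≤ y ^ (ρ - σ) := Real.rpow_le_rpow_of_nonpos hy0 hyx (by linarith)
    calc x ^ ρ * (y ^ (-σ) * z ^ (-σ)) ≤ x ^ ρ * (y ^ (-σ) * (4 ^ σ * x ^ (-σ))) := by gcongr
      _ = 4 ^ σ * (x ^ (ρ - σ) * y ^ (-σ)) := by
        rw [sub_eq_add_neg, Real.rpow_add hx0]; ring
      _ ≤ 4 ^ σ * (y ^ (ρ - σ) * y ^ (-σ)) := by gcongr
      _ = 4 ^ σ * y ^ (ρ - 2 * σ) := by rw [← Real.rpow_add hy0]; congr 2; ring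
      _ ≤ _ := by gcongr; linarith

/-- The kernel of the product estimate is dominated by a sum of functions of a single frequency.
The reason is that the larger of `y`, `z` dominates `x`. -/
lemma kernel_le {x y z σ ρ : ℝ} (hx : 1 ≤ x) (hy : 1 ≤ y) (hz : 1 ≤ z) (hσ : 0 ≤ σ) (hρ : ρ ≤ σ)
    (hxyz : x ≤ 4 * max y z) :
    x ^ ρ * (y ^ (-σ) * z ^ (-σ)) ≤
      4 ^ σ * (x ^ (ρ - 2 * σ) + y ^ (ρ - 2 * σ) + z ^ (ρ - 2 * σ)) := by
  have py : 0 ≤ y ^ (ρ - 2 * σ) := by positivity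
  have pz : 0 ≤ z ^ (ρ - 2 * σ) := by positivity
  rcases le_total y z with h | h
  · rw [max_eq_right h] at hxyz
    exact (kernel_le_of_le hx hy hσ hρ h hxyz).trans
      (mul_le_mul_of_nonneg_left (by linarith) (by positivity))
  · rw [max_eq_left h] at hxyz
    rw [mul_comm (y ^ (-σ))]
    exact (kernel_le_of_le hx hz hσ hρ h hxyz).trans
      (mul_le_mul_of_nonneg_left (by linarith) (by positivity))

/-! ### A trilinear convolution inequality -/

/-- The `L²` norm of a nonnegative function on the line. -/
def l2 (a : ℝ → ℝ≥0∞) : ℝ≥0∞ := (∫⁻ x, a x ^ (2 : ℝ)) ^ (1 / (2 : ℝ))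

lemma lintegral_mul_le_l2 {a b : ℝ → ℝ≥0∞} (ha : Measurable a) (hb : Measurable b) :
    ∫⁻ x, a x * b x ≤ l2 a * l2 b :=
  ENNReal.lintegral_mul_le_Lp_mul_Lq volume Real.HolderConjugate.two_two ha.aemeasurable
    hb.aemeasurable

lemma l2_comp_sub_left (b : ℝ → ℝ≥0∞) (x : ℝ) : l2 (fun t => b (x - t)) = l2 b := by
  unfold l2
  rw [lintegral_sub_left_eq_self (fun t => b t ^ (2 : ℝ))]

lemma l2_comp_sub_right (b : ℝ → ℝ≥0∞) (x : ℝ) : l2 (fun t => b (t - x)) = l2 b := by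
  unfold l2
  rw [lintegral_sub_right_eq_self (fun t => b t ^ (2 : ℝ))]

lemma l2_eq_enorm_toLp (f : 𝓢(ℝ, ℂ)) : l2 (fun x => ‖f x‖ₑ) = ‖f.toLp 2 volume‖ₑ := by
  rw [Lp.enorm_def, eLpNorm_congr_ae (f.coeFn_toLp 2 volume),
    eLpNorm_eq_lintegral_rpow_enorm_toReal (by simp) (by simp)]
  simp [l2]

/-- The trilinear convolution form `∫∫ c(ξ) a(t) b(ξ - t) dt dξ`. -/
def trilinear (c a b : ℝ → ℝ≥0∞) : ℝ≥0∞ := ∫⁻ ξ, ∫⁻ t, c ξ * (a t * b (ξ - t))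

lemma trilinear_swap (c a b : ℝ → ℝ≥0∞) : trilinear c a b = trilinear c b a := by
  unfold trilinear
  congr 1 with ξ
  rw [← lintegral_sub_left_eq_self _ ξ]
  congr 1 with t
  rw [sub_sub_cancel, mul_comm (a _)]

lemma trilinear_le_left {a b c : ℝ → ℝ≥0∞} (ha : Measurable a) (hb : Measurable b)
    (hc : Measurable c) : trilinear c a b ≤ (∫⁻ ξ, c ξ) * (l2 a * l2 b) := by
  unfold trilinear
  rw [← lintegral_mul_const _ hc]
  gcongr with ξ
  rw [lintegral_const_mul _ (by fun_prop)]
  gcongr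
  rw [← l2_comp_sub_left b ξ]
  exact lintegral_mul_le_l2 ha (by fun_prop)

lemma trilinear_le_middle {a b c : ℝ → ℝ≥0∞} (ha : Measurable a) (hb : Measurable b)
    (hc : Measurable c) : trilinear c a b ≤ (∫⁻ t, a t) * (l2 c * l2 b) := by
  unfold trilinear
  rw [lintegral_lintegral_swap (by fun_prop), ← lintegral_mul_const _ ha]
  gcongr with t
  simp_rw [mul_left_comm]
  rw [lintegral_const_mul _ (by fun_prop)]
  gcongr
  rw [← l2_comp_sub_right b t]
  exact lintegral_mul_le_l2 hc (by fun_prop)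

/-- If the kernel of a trilinear form is dominated by a sum of square integrable functions `w` of
the single frequencies, then the form is bounded on `L² × L² × L²`: in each summand one of the
three functions becomes integrable, and Cauchy–Schwarz takes care of the other two. -/
lemma trilinear_weighted_le {a b c w : ℝ → ℝ≥0∞} (ha : Measurable a) (hb : Measurable b)
    (hc : Measurable c) (hw : Measurable w) :
    ∫⁻ ξ, ∫⁻ t, (w ξ + w t + w (ξ - t)) * (c ξ * (a t * b (ξ - t))) ≤
      3 * l2 w * (l2 c * (l2 a * l2 b)) := by
  have h1 : trilinear (fun ξ => w ξ * c ξ) a b ≤ l2 w * l2 c * (l2 a * l2 b) :=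
    (trilinear_le_left ha hb (by fun_prop)).trans (by gcongr; exact lintegral_mul_le_l2 hw hc)
  have h2 : trilinear c (fun t => w t * a t) b ≤ l2 w * l2 a * (l2 c * l2 b) :=
    (trilinear_le_middle (by fun_prop) hb hc).trans (by gcongr; exact lintegral_mul_le_l2 hw ha)
  have h3 : trilinear c a (fun t => w t * b t) ≤ l2 w * l2 b * (l2 c * l2 a) := by
    rw [trilinear_swap]
    exact (trilinear_le_middle (by fun_prop) ha hc).trans
      (by gcongr; exact lintegral_mul_le_l2 hw hb)
  calc _ = trilinear (fun ξ => w ξ * c ξ) a b + trilinear c (fun t => w t * a t) b +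
        trilinear c a (fun t => w t * b t) := by
        unfold trilinear
        rw [← lintegral_add_left (by fun_prop), ← lintegral_add_left (by fun_prop)]
        congr 1 with ξ
        rw [← lintegral_add_left (by fun_prop), ← lintegral_add_left (by fun_prop)]
        congr 1 with t
        ring
    _ ≤ _ := add_le_add (add_le_add h1 h2) h3
    _ = _ := by ring

/-- The weight `(1 + 4π²ξ²)^{-μ}` that dominates the kernel of the product estimate. -/
def weight (μ : ℝ) (ξ : ℝ) : ℝ≥0∞ := ENNReal.ofReal (bracketSq ξ ^ (-μ))

lemma measurable_weight (μ : ℝ) : Measurable (weight μ) := by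
  have := continuous_bracketSq.measurable
  unfold weight
  fun_prop

lemma l2_weight_lt_top {μ : ℝ} (hμ : 1 / 4 < μ) : l2 (weight μ) < ∞ := by
  have h1 := integrable_rpow_neg_one_add_norm_sq (E := ℝ) (μ := volume) (r := 4 * μ)
    (by simp; linarith)
  have h2 := (h1.comp_mul_left' (R := 2 * Real.pi) (by positivity)).lintegral_lt_top
  refine ENNReal.rpow_lt_top_of_nonneg (by norm_num) (ne_of_lt ?_)
  convert h2 using 3 with ξ
  rw [weight, ENNReal.ofReal_rpow_of_nonneg (by have := bracketSq_pos ξ; positivity) (by norm_num),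
    ← Real.rpow_mul (bracketSq_pos ξ).le]
  congr 2
  · rw [bracketSq, Real.norm_eq_abs, sq_abs]; ring
  · ring

/-! ### Fourier multipliers on Schwartz functions -/

open FourierTransform

/-- The Bessel potential `J^s` on Schwartz functions. -/
def besselS (s : ℝ) : 𝓢(ℝ, ℂ) →L[ℂ] 𝓢(ℝ, ℂ) :=
  SchwartzMap.fourierMultiplierCLM ℂ (besselSymbol s)

lemma besselSymbol_neg (s ξ : ℝ) : besselSymbol s (-ξ) = besselSymbol s ξ := by
  simp [besselSymbol]

lemma besselSymbol_mul (s s' : ℝ) : besselSymbol s * besselSymbol s' = besselSymbol (s + s') := by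
  ext ξ
  have : 0 < 1 + 4 * Real.pi ^ 2 * ξ ^ 2 := bracketSq_pos ξ
  simp only [besselSymbol, Pi.mul_apply, ← Complex.ofReal_mul, ← Real.rpow_add this, add_div]

lemma norm_besselSymbol_le_one {s : ℝ} (hs : s ≤ 0) (ξ : ℝ) : ‖besselSymbol s ξ‖ ≤ 1 := by
  rw [norm_besselSymbol]
  exact Real.rpow_le_one_of_one_le_of_nonpos (one_le_bracketSq ξ) (by linarith)

lemma besselS_besselS (s s' : ℝ) (φ : 𝓢(ℝ, ℂ)) :
    besselS s (besselS s' φ) = besselS (s + s') φ := by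
  rw [besselS, besselS, SchwartzMap.fourierMultiplierCLM_fourierMultiplierCLM_apply
    (hasTemperateGrowth_besselSymbol s) (hasTemperateGrowth_besselSymbol s'), besselSymbol_mul]
  rfl

lemma besselS_zero (φ : 𝓢(ℝ, ℂ)) : besselS 0 φ = φ := by
  have : besselSymbol 0 = fun _ => 1 := by ext; simp [besselSymbol]
  simp [besselS, this]

lemma fourier_reflect (f : 𝓢(ℝ, ℂ)) (x : ℝ) : 𝓕 f (-x) = 𝓕⁻ f x := by
  rw [SchwartzMap.fourier_coe, SchwartzMap.fourierInv_coe, Real.fourierInv_eq_fourier_neg]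

/-- For an even symbol it does not matter in which order the Fourier transform and its inverse
are taken. -/
lemma fourier_smulLeft_fourierInv {m : ℝ → ℂ} (hm : m.HasTemperateGrowth)
    (heven : ∀ ξ, m (-ξ) = m ξ) (φ : 𝓢(ℝ, ℂ)) :
    𝓕 (SchwartzMap.smulLeftCLM ℂ m (𝓕⁻ φ)) = SchwartzMap.fourierMultiplierCLM ℂ m φ := by
  ext x
  rw [SchwartzMap.fourierMultiplierCLM_apply, SchwartzMap.fourier_coe, SchwartzMap.fourierInv_coe,
    Real.fourier_eq', Real.fourierInv_eq', ← integral_neg_eq_self]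
  congr 1 with ξ
  rw [SchwartzMap.smulLeftCLM_apply_apply hm, SchwartzMap.smulLeftCLM_apply_apply hm, heven,
    ← fourier_reflect, neg_neg]
  simp

/-- The Bessel potential is symmetric with respect to the bilinear pairing, as its symbol is
even. -/
lemma bessel_apply (s : ℝ) (T : 𝓢'(ℝ, ℂ)) (φ : 𝓢(ℝ, ℂ)) : bessel s T φ = T (besselS s φ) := by
  rw [bessel, TemperedDistribution.fourierMultiplierCLM_apply_apply, fourier_smulLeft_fourierInv
    (hasTemperateGrowth_besselSymbol s) (besselSymbol_neg s)]
  rfl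

lemma bessel_bessel (s s' : ℝ) (T : 𝓢'(ℝ, ℂ)) : bessel s (bessel s' T) = bessel (s + s') T := by
  ext φ
  rw [bessel_apply, bessel_apply, bessel_apply, besselS_besselS, add_comm]

lemma bessel_zero (T : 𝓢'(ℝ, ℂ)) : bessel 0 T = T := by
  ext φ
  rw [bessel_apply, besselS_zero]

lemma norm_fourierMultiplier_le {m : ℝ → ℂ} (hm : m.HasTemperateGrowth) (hm1 : ∀ ξ, ‖m ξ‖ ≤ 1)
    (φ : 𝓢(ℝ, ℂ)) :
    ‖(SchwartzMap.fourierMultiplierCLM ℂ m φ).toLp 2 volume‖ ≤ ‖φ.toLp 2 volume‖ := by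
  rw [← SchwartzMap.norm_fourier_toL2_eq, ← SchwartzMap.norm_fourier_toL2_eq φ,
    SchwartzMap.fourierMultiplierCLM_apply, fourier_fourierInv_eq]
  refine Lp.norm_le_norm_of_ae_le ?_
  filter_upwards [(𝓕 φ).coeFn_toLp 2 volume,
    (SchwartzMap.smulLeftCLM ℂ m (𝓕 φ)).coeFn_toLp 2 volume] with ξ h1 h2
  rw [h1, h2, SchwartzMap.smulLeftCLM_apply_apply hm, norm_smul]
  exact mul_le_of_le_one_left (norm_nonneg _) (hm1 ξ)

lemma norm_besselS_le {s : ℝ} (hs : s ≤ 0) (φ : 𝓢(ℝ, ℂ)) :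
    ‖(besselS s φ).toLp 2 volume‖ ≤ ‖φ.toLp 2 volume‖ :=
  norm_fourierMultiplier_le (hasTemperateGrowth_besselSymbol s) (norm_besselSymbol_le_one hs) φ

/-- The symbol `2πiξ (1 + 4π²ξ²)^{-1/2}` of `∂ₓ J⁻¹`. -/
def derivSymbol (ξ : ℝ) : ℂ := (2 * Real.pi * Complex.I) * ((ξ : ℂ) * besselSymbol (-1) ξ)

lemma hasTemperateGrowth_derivSymbol : derivSymbol.HasTemperateGrowth := by
  have := hasTemperateGrowth_besselSymbol (-1)
  unfold derivSymbol
  fun_prop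

lemma norm_derivSymbol_le_one (ξ : ℝ) : ‖derivSymbol ξ‖ ≤ 1 := by
  have h0 := bracketSq_pos ξ
  rw [derivSymbol, norm_mul, norm_mul (ξ : ℂ), norm_besselSymbol, neg_div, Real.rpow_neg h0.le,
    ← Real.sqrt_eq_rpow, ← mul_assoc, mul_inv_le_iff₀ (Real.sqrt_pos.2 h0), one_mul]
  refine Real.le_sqrt_of_sq_le ?_
  simp [bracketSq, abs_of_pos Real.pi_pos, mul_pow]
  linarith

/-- `∂ₓ J^s = J^{s+1} (∂ₓ J⁻¹)`, where `∂ₓ J⁻¹` is a contraction of `L²`. -/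
lemma derivCLM_besselS (s : ℝ) (φ : 𝓢(ℝ, ℂ)) :
    SchwartzMap.derivCLM ℂ ℂ (besselS s φ) =
      besselS (s + 1) (SchwartzMap.fourierMultiplierCLM ℂ derivSymbol φ) := by
  have h1 : SchwartzMap.derivCLM ℂ ℂ (besselS s φ) =
      (2 * Real.pi * Complex.I) •
        SchwartzMap.fourierMultiplierCLM ℂ (fun ξ : ℝ => (ξ : ℂ)) (besselS s φ) := by
    have h0 : SchwartzMap.derivCLM ℂ ℂ (besselS s φ) =
        LineDeriv.lineDerivOp (1 : ℝ) (besselS s φ) := by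
      ext x
      rw [SchwartzMap.derivCLM_apply, SchwartzMap.lineDerivOp_apply_eq_fderiv,
        fderiv_apply_one_eq_deriv]
    have := SchwartzMap.lineDeriv_eq_fourierMultiplierCLM (1 : ℝ) (besselS s φ)
    rw [← h0, ← SchwartzMap.fourierMultiplierCLM_ofReal ℂ (by fun_prop)] at this
    simpa using this
  have hm := hasTemperateGrowth_besselSymbol s
  rw [h1, besselS, besselS, SchwartzMap.fourierMultiplierCLM_fourierMultiplierCLM_apply
    (by fun_prop) hm, SchwartzMap.fourierMultiplierCLM_fourierMultiplierCLM_apply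
    (hasTemperateGrowth_besselSymbol _) hasTemperateGrowth_derivSymbol,
    ← smul_apply, ← SchwartzMap.fourierMultiplierCLM_smul (by fun_prop)]
  congr 2
  ext ξ
  have := congrFun (besselSymbol_mul (s + 1) (-1)) ξ
  simp only [Pi.mul_apply, add_neg_cancel_right] at this
  simp only [Pi.smul_apply, Pi.mul_apply, smul_eq_mul, derivSymbol, ← this]
  ring

/-! ### The product estimate -/

lemma enorm_convolution_le (A : 𝓢(ℝ, ℂ)) (ξ : ℝ) :
    ‖SchwartzMap.convolution (ContinuousLinearMap.mul ℂ ℂ) A A ξ‖ₑ ≤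
      ∫⁻ t, ‖A t‖ₑ * ‖A (ξ - t)‖ₑ := by
  rw [SchwartzMap.convolution_apply, MeasureTheory.convolution]
  refine (enorm_integral_le_lintegral_enorm _).trans_eq ?_
  simp

lemma enorm_besselSymbol (s ξ : ℝ) :
    ‖besselSymbol s ξ‖ₑ = ENNReal.ofReal (bracketSq ξ ^ (s / 2)) := by
  rw [← ofReal_norm, norm_besselSymbol]

lemma enorm_kernel_le {s r : ℝ} (hs : 0 ≤ s) (hr : r ≤ s) (ξ t : ℝ) :
    ‖besselSymbol r ξ‖ₑ * (‖besselSymbol (-s) t‖ₑ * ‖besselSymbol (-s) (ξ - t)‖ₑ) ≤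
      ENNReal.ofReal (4 ^ (s / 2)) *
        (weight (s - r / 2) ξ + weight (s - r / 2) t + weight (s - r / 2) (ξ - t)) := by
  have h := kernel_le (ρ := r / 2) (σ := s / 2) (one_le_bracketSq ξ) (one_le_bracketSq t)
    (one_le_bracketSq (ξ - t)) (by linarith) (by linarith)
    (by simpa using bracketSq_add_le t (ξ - t))
  have p1 := bracketSq_pos ξ
  have p2 := bracketSq_pos t
  have p3 := bracketSq_pos (ξ - t)
  simp only [enorm_besselSymbol, weight]
  rw [← ENNReal.ofReal_mul (by positivity), ← ENNReal.ofReal_mul (by positivity),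
    ← ENNReal.ofReal_add (by positivity) (by positivity),
    ← ENNReal.ofReal_add (by positivity) (by positivity), ← ENNReal.ofReal_mul (by positivity)]
  refine ENNReal.ofReal_le_ofReal ?_
  convert h using 3 <;> (try congr 2) <;> ring_nf

/-- The product estimate `H^s · H^s ⊆ H^r` in dual form, for Schwartz functions: the square of
`J^{-s} S` pairs with `J^r φ`. On the Fourier side this is a trilinear convolution form, whose
kernel is controlled by `enorm_kernel_le`. -/
lemma exists_norm_integral_besselS_sq_le {s r : ℝ} (hs : 0 ≤ s) (hr : r ≤ s)
    (hrs : r < 2 * s - 1 / 2) :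
    ∃ C : ℝ, 0 ≤ C ∧ ∀ S φ : 𝓢(ℝ, ℂ), ‖∫ x, besselS r φ x * besselS (-s) S x ^ 2‖ ≤
      C * (‖S.toLp 2 volume‖ ^ 2 * ‖φ.toLp 2 volume‖) := by
  set w := weight (s - r / 2) with hw
  have hwm : Measurable w := measurable_weight _
  have hwt : l2 w < ∞ := l2_weight_lt_top (by linarith)
  set K : ℝ≥0∞ := ENNReal.ofReal (4 ^ (s / 2)) * (3 * l2 w) with hK
  have hKt : K ≠ ∞ := by finiteness
  refine ⟨K.toReal, ENNReal.toReal_nonneg, fun S φ => ?_⟩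
  have hms := hasTemperateGrowth_besselSymbol (-s)
  have hmr := hasTemperateGrowth_besselSymbol r
  set A := SchwartzMap.smulLeftCLM ℂ (besselSymbol (-s)) (𝓕⁻ S) with hA
  set χ := SchwartzMap.smulLeftCLM ℂ (besselSymbol r) (𝓕 φ) with hχ
  have eS : besselS (-s) S = 𝓕 A :=
    (fourier_smulLeft_fourierInv hms (besselSymbol_neg _) S).symm
  have eφ : besselS r φ = 𝓕⁻ χ := rfl
  have e1 : ∫ x, besselS r φ x * besselS (-s) S x ^ 2 =
      ∫ ξ, χ ξ * SchwartzMap.convolution (ContinuousLinearMap.mul ℂ ℂ) A A ξ := by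
    have := SchwartzMap.integral_fourierInv_mul_eq χ
      (𝓕 (SchwartzMap.convolution (ContinuousLinearMap.mul ℂ ℂ) A A))
    rw [fourierInv_fourier_eq, SchwartzMap.fourier_convolution] at this
    rw [← this, eS, eφ]
    congr 1 with x
    simp [sq]
  have hAt (t : ℝ) : ‖A t‖ₑ = ‖besselSymbol (-s) t‖ₑ * ‖𝓕⁻ S t‖ₑ := by
    rw [hA, SchwartzMap.smulLeftCLM_apply_apply hms, enorm_smul]
  have hχt (ξ : ℝ) : ‖χ ξ‖ₑ = ‖besselSymbol r ξ‖ₑ * ‖𝓕 φ ξ‖ₑ := by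
    rw [hχ, SchwartzMap.smulLeftCLM_apply_apply hmr, enorm_smul]
  have e2 : ‖∫ x, besselS r φ x * besselS (-s) S x ^ 2‖ₑ ≤
      K * (‖φ.toLp 2 volume‖ₑ * (‖S.toLp 2 volume‖ₑ * ‖S.toLp 2 volume‖ₑ)) := by
    rw [e1]
    have hcm : Measurable fun ξ => ‖𝓕 φ ξ‖ₑ := (𝓕 φ).continuous.measurable.enorm
    have ham : Measurable fun ξ => ‖𝓕⁻ S ξ‖ₑ := (𝓕⁻ S).continuous.measurable.enorm
    have hAm : Measurable fun ξ => ‖A ξ‖ₑ := A.continuous.measurable.enorm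
    have nφ : ‖φ.toLp 2 volume‖ₑ = l2 fun ξ => ‖𝓕 φ ξ‖ₑ := by
      rw [l2_eq_enorm_toLp, enorm_eq_iff_norm_eq, SchwartzMap.norm_fourier_toL2_eq]
    have nS : ‖S.toLp 2 volume‖ₑ = l2 fun ξ => ‖𝓕⁻ S ξ‖ₑ := by
      rw [l2_eq_enorm_toLp, enorm_eq_iff_norm_eq, ← SchwartzMap.norm_fourier_toL2_eq (𝓕⁻ S),
        fourier_fourierInv_eq]
    calc _ ≤ ∫⁻ ξ, ‖χ ξ * SchwartzMap.convolution (ContinuousLinearMap.mul ℂ ℂ) A A ξ‖ₑ :=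
          enorm_integral_le_lintegral_enorm _
      _ ≤ ∫⁻ ξ, ‖χ ξ‖ₑ * ∫⁻ t, ‖A t‖ₑ * ‖A (ξ - t)‖ₑ := by
          gcongr with ξ
          rw [enorm_mul]
          gcongr
          exact enorm_convolution_le A ξ
      _ = ∫⁻ ξ, ∫⁻ t, ‖χ ξ‖ₑ * (‖A t‖ₑ * ‖A (ξ - t)‖ₑ) := by
          congr 1 with ξ
          rw [lintegral_const_mul _ (by fun_prop)]
      _ ≤ ∫⁻ ξ, ∫⁻ t, ENNReal.ofReal (4 ^ (s / 2)) * ((w ξ + w t + w (ξ - t)) *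
            (‖𝓕 φ ξ‖ₑ * (‖𝓕⁻ S t‖ₑ * ‖𝓕⁻ S (ξ - t)‖ₑ))) := by
          refine lintegral_mono fun ξ => lintegral_mono fun t => ?_
          simp only [hχt, hAt]
          calc _ = (‖besselSymbol r ξ‖ₑ *
                (‖besselSymbol (-s) t‖ₑ * ‖besselSymbol (-s) (ξ - t)‖ₑ)) *
                (‖𝓕 φ ξ‖ₑ * (‖𝓕⁻ S t‖ₑ * ‖𝓕⁻ S (ξ - t)‖ₑ)) := by ring
            _ ≤ _ := by
              rw [← mul_assoc (ENNReal.ofReal _)]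
              exact mul_le_mul_left (enorm_kernel_le hs hr ξ t) _
      _ = ENNReal.ofReal (4 ^ (s / 2)) * ∫⁻ ξ, ∫⁻ t, (w ξ + w t + w (ξ - t)) *
            (‖𝓕 φ ξ‖ₑ * (‖𝓕⁻ S t‖ₑ * ‖𝓕⁻ S (ξ - t)‖ₑ)) := by
          simp_rw [lintegral_const_mul' _ _ ENNReal.ofReal_ne_top]
      _ ≤ _ := by
          rw [hK, nφ, nS, mul_assoc]
          gcongr
          exact trilinear_weighted_le ham ham hcm hwm
  have := ENNReal.toReal_mono (by finiteness) e2
  simp only [ENNReal.toReal_mul, toReal_enorm] at this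
  refine this.trans_eq ?_
  ring

/-! ### Square integrable distributions -/

lemma toTemperedDistribution_injective {f g : Lp ℂ 2 (volume : Measure ℝ)}
    (h : (f : 𝓢'(ℝ, ℂ)) = (g : 𝓢'(ℝ, ℂ))) : f = g :=
  LinearMap.ker_eq_bot.1
    (Lp.ker_toTemperedDistributionCLM_eq_bot (F := ℂ) (μ := (volume : Measure ℝ)) (p := 2)) h

lemma norm_star_Lp (g : Lp ℂ 2 (volume : Measure ℝ)) : ‖star g‖ = ‖g‖ := by
  rw [Lp.norm_def, Lp.norm_def]
  congr 1
  refine eLpNorm_congr_norm_ae ?_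
  filter_upwards [Lp.coeFn_star g] with x hx
  simp [hx]

lemma norm_toTemperedDistribution_apply_le (g : Lp ℂ 2 (volume : Measure ℝ)) (φ : 𝓢(ℝ, ℂ)) :
    ‖(g : 𝓢'(ℝ, ℂ)) φ‖ ≤ ‖g‖ * ‖φ.toLp 2 volume‖ := by
  have h : (g : 𝓢'(ℝ, ℂ)) φ = inner ℂ (star g) (φ.toLp 2 volume) := by
    rw [Lp.toTemperedDistribution_apply, L2.inner_def]
    refine integral_congr_ae ?_
    filter_upwards [φ.coeFn_toLp 2 volume, Lp.coeFn_star g] with x h1 h2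
    simp [h1, h2]
  rw [h]
  simpa [norm_star_Lp] using norm_inner_le_norm (𝕜 := ℂ) (star g) (φ.toLp 2 volume)

/-- A tempered distribution that is bounded in the `L²` norm is an `L²` function. -/
lemma exists_eq_toTemperedDistribution (T : 𝓢'(ℝ, ℂ)) {M : ℝ} (hM : 0 ≤ M)
    (hT : ∀ φ : 𝓢(ℝ, ℂ), ‖T φ‖ ≤ M * ‖φ.toLp 2 volume‖) :
    ∃ g : Lp ℂ 2 (volume : Measure ℝ), T = (g : 𝓢'(ℝ, ℂ)) ∧ ‖g‖ ≤ M := by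
  set e := (SchwartzMap.toLpCLM ℂ (E := ℝ) ℂ 2 volume).toLinearMap
  have hd : DenseRange e := SchwartzMap.denseRange_toLpCLM (p := 2) ENNReal.ofNat_ne_top
  set ℓ : Lp ℂ 2 (volume : Measure ℝ) →L[ℂ] ℂ := LinearMap.extendOfNorm (T : 𝓢(ℝ, ℂ) →ₗ[ℂ] ℂ) e
  have hℓ : ∀ φ : 𝓢(ℝ, ℂ), ℓ (φ.toLp 2 volume) = T φ := fun φ =>
    LinearMap.extendOfNorm_eq hd ⟨M, hT⟩ φ
  have hℓM : ‖ℓ‖ ≤ M := LinearMap.opNorm_extendOfNorm_le hd hM hT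
  set h := (InnerProductSpace.toDual ℂ (Lp ℂ 2 (volume : Measure ℝ))).symm ℓ
  refine ⟨star h, ?_, ?_⟩
  · ext φ
    rw [← hℓ, ← InnerProductSpace.toDual_symm_apply, Lp.toTemperedDistribution_apply,
      L2.inner_def]
    refine integral_congr_ae ?_
    filter_upwards [φ.coeFn_toLp 2 volume, Lp.coeFn_star h] with x h1 h2
    simp only [h1, h2]
    simp [h]
  · rw [norm_star_Lp]
    simpa [h] using hℓM

/-! ### Squares of functions in `H^s` -/

/-- The product of two `L²` functions, as a continuous bilinear map into `L¹`. -/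
abbrev mulL2 : Lp ℂ 2 (volume : Measure ℝ) →L[ℂ] Lp ℂ 2 (volume : Measure ℝ) →L[ℂ]
    Lp ℂ 1 (volume : Measure ℝ) :=
  (ContinuousLinearMap.mul ℂ ℂ).holderL volume 2 2 1

lemma mulL2_self_apply (g : Lp ℂ 2 (volume : Measure ℝ)) (ψ : 𝓢(ℝ, ℂ)) :
    ((mulL2 g g : Lp ℂ 1 (volume : Measure ℝ)) : 𝓢'(ℝ, ℂ)) ψ = ∫ x, ψ x * g x ^ 2 := by
  rw [Lp.toTemperedDistribution_apply]
  refine integral_congr_ae ?_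
  filter_upwards [(ContinuousLinearMap.mul ℂ ℂ).coeFn_holder (r := 1) g g] with x hx
  rw [ContinuousLinearMap.holderL_apply_apply, hx]
  simp [sq]

/-- A real `L²` function as a complex one. -/
abbrev toComplex (f : Lp ℝ 2 (volume : Measure ℝ)) : Lp ℂ 2 (volume : Measure ℝ) :=
  Complex.ofRealCLM.compLp f

lemma sqDist_eq (f : Lp ℝ 2 (volume : Measure ℝ)) :
    sqDist f = (mulL2 (toComplex f) (toComplex f) : Lp ℂ 1 (volume : Measure ℝ)) := by
  ext ψ
  rw [mulL2_self_apply, sqDist, Lp.toTemperedDistribution_apply]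
  refine integral_congr_ae ?_
  filter_upwards [Complex.ofRealCLM.coeFn_compLp f,
    ((Lp.memLp f).integrable_sq.ofReal (𝕜 := ℂ)).coeFn_toL1] with x h1 h2
  rw [h1]
  refine (congrArg (ψ x • ·) h2).trans ?_
  simp

lemma toDist_sub (f g : Lp ℝ 2 (volume : Measure ℝ)) :
    toDist (f - g) = toDist f - toDist g := by
  have : toComplex (f - g) = toComplex f - toComplex g :=
    map_sub (Complex.ofRealCLM.compLpL 2 volume) f g
  change ((toComplex (f - g) : Lp ℂ 2 (volume : Measure ℝ)) : 𝓢'(ℝ, ℂ)) = _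
  rw [this]
  exact map_sub (Lp.toTemperedDistributionCLM ℂ volume 2) _ _

lemma bessel_sub_toTemperedDistribution (s : ℝ) (S : 𝓢(ℝ, ℂ)) (g G : Lp ℂ 2 (volume : Measure ℝ))
    (hg : bessel s (G : 𝓢'(ℝ, ℂ)) = (g : 𝓢'(ℝ, ℂ))) :
    bessel s ((S.toLp 2 volume - G : Lp ℂ 2 (volume : Measure ℝ)) : 𝓢'(ℝ, ℂ)) =
      (((besselS s S).toLp 2 volume - g : Lp ℂ 2 (volume : Measure ℝ)) : 𝓢'(ℝ, ℂ)) := by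
  have e : ∀ a b : Lp ℂ 2 (volume : Measure ℝ), ((a - b : Lp ℂ 2 (volume : Measure ℝ)) :
      𝓢'(ℝ, ℂ)) = (a : 𝓢'(ℝ, ℂ)) - (b : 𝓢'(ℝ, ℂ)) :=
    map_sub (Lp.toTemperedDistributionCLM ℂ volume 2)
  rw [e, e, map_sub, hg, Lp.toTemperedDistribution_toLp_eq, Lp.toTemperedDistribution_toLp_eq,
    bessel, TemperedDistribution.fourierMultiplierCLM_toTemperedDistributionCLM_eq
      (hasTemperateGrowth_besselSymbol s)]
  rfl

/-- For `s ≤ 0` the Bessel potential `J^s` is a contraction of `L²`. -/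
lemma norm_le_of_bessel_eq {s : ℝ} (hs : s ≤ 0) {G g : Lp ℂ 2 (volume : Measure ℝ)}
    (hg : bessel s (G : 𝓢'(ℝ, ℂ)) = (g : 𝓢'(ℝ, ℂ))) : ‖g‖ ≤ ‖G‖ := by
  obtain ⟨g', hg', hle⟩ := exists_eq_toTemperedDistribution (bessel s (G : 𝓢'(ℝ, ℂ)))
    (norm_nonneg G) fun φ => by
      rw [bessel_apply]
      exact (norm_toTemperedDistribution_apply_le G _).trans
        (by gcongr; exact norm_besselS_le hs φ)
  rwa [toTemperedDistribution_injective (hg.symm.trans hg')]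

/-- The product estimate in dual form for `f ∈ H^s`: by density of the Schwartz functions in
`L² ∋ J^s f` it follows from the one for Schwartz functions. -/
lemma exists_norm_sqDist_le {s r : ℝ} (hs : 0 ≤ s) (hr : r ≤ s) (hrs : r < 2 * s - 1 / 2) :
    ∃ C : ℝ, 0 ≤ C ∧ ∀ (f : Lp ℝ 2 (volume : Measure ℝ)) (F : Lp ℂ 2 (volume : Measure ℝ)),
      bessel s (toDist f) = (F : 𝓢'(ℝ, ℂ)) → ∀ φ : 𝓢(ℝ, ℂ),
        ‖sqDist f (besselS r φ)‖ ≤ C * (‖F‖ ^ 2 * ‖φ.toLp 2 volume‖) := by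
  obtain ⟨C, hC, h⟩ := exists_norm_integral_besselS_sq_le hs hr hrs
  refine ⟨C, hC, fun f F hF φ => ?_⟩
  have hf : bessel (-s) (F : 𝓢'(ℝ, ℂ)) = (toComplex f : 𝓢'(ℝ, ℂ)) := by
    rw [← hF, bessel_bessel, neg_add_cancel, bessel_zero]
    rfl
  obtain ⟨G, hG, hGF⟩ := mem_closure_iff_seq_limit.1
    ((SchwartzMap.denseRange_toLpCLM (E := ℝ) (F := ℂ) (μ := volume) (p := 2)
      ENNReal.ofNat_ne_top) F)
  choose S hS using hG
  have hSF : Tendsto (fun n => (S n).toLp 2 volume) atTop (𝓝 F) := by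
    convert hGF using 2 with n
    exact hS n
  have hSf : Tendsto (fun n => (besselS (-s) (S n)).toLp 2 volume) atTop (𝓝 (toComplex f)) := by
    rw [tendsto_iff_norm_sub_tendsto_zero] at hSF ⊢
    refine squeeze_zero (fun _ => norm_nonneg _) (fun n => ?_) hSF
    exact norm_le_of_bessel_eq (by linarith) (bessel_sub_toTemperedDistribution _ _ _ _ hf)
  have hcont : Continuous fun g : Lp ℂ 2 (volume : Measure ℝ) =>
      ((mulL2 g g : Lp ℂ 1 (volume : Measure ℝ)) : 𝓢'(ℝ, ℂ)) (besselS r φ) := by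
    have h1 : Continuous fun g : Lp ℂ 2 (volume : Measure ℝ) => mulL2 g g := by fun_prop
    have h2 : Continuous fun T : 𝓢'(ℝ, ℂ) => T (besselS r φ) :=
      (PointwiseConvergenceCLM.evalCLM (RingHom.id ℂ) ℂ (besselS r φ)).continuous
    exact h2.comp ((Lp.toTemperedDistributionCLM ℂ volume 1).continuous.comp h1)
  rw [sqDist_eq]
  refine le_of_tendsto_of_tendsto (((hcont.tendsto _).comp hSf).norm)
    (((hSF.norm.pow 2).mul_const ‖φ.toLp 2 volume‖).const_mul C) (.of_forall fun n => ?_)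
  have : ((mulL2 ((besselS (-s) (S n)).toLp 2 volume) ((besselS (-s) (S n)).toLp 2 volume) :
      Lp ℂ 1 (volume : Measure ℝ)) : 𝓢'(ℝ, ℂ)) (besselS r φ) =
      ∫ x, besselS r φ x * besselS (-s) (S n) x ^ 2 := by
    rw [mulL2_self_apply]
    refine integral_congr_ae ?_
    filter_upwards [(besselS (-s) (S n)).coeFn_toLp 2 volume] with x hx
    rw [hx]
  simp only [Function.comp_apply, this]
  exact h (S n) φ

lemma hsNorm_eq {s : ℝ} {f : Lp ℝ 2 (volume : Measure ℝ)} {g : Lp ℂ 2 (volume : Measure ℝ)}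
    (hg : bessel s (toDist f) = (g : 𝓢'(ℝ, ℂ))) : hsNorm s f = ‖g‖ₑ := by
  refine le_antisymm (iInf₂_le g hg) (le_iInf₂ fun g' hg' => ?_)
  rw [toTemperedDistribution_injective (hg.symm.trans hg')]

/-! ### Smoothing of the nonlinear evolution -/

/-- The vector field of the equation maps bounded sets of `H^s` to bounded sets of `H^{s+η}`. -/
lemma exists_norm_vectorField_le {s η : ℝ} (hs : 0 ≤ s) (hη : η ≤ 1) (hsη : η < s + 1 / 2) :
    ∃ C : ℝ, 0 ≤ C ∧ ∀ (f : Lp ℝ 2 (volume : Measure ℝ)) (F : Lp ℂ 2 (volume : Measure ℝ)),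
      bessel s (toDist f) = (F : 𝓢'(ℝ, ℂ)) → ∀ φ : 𝓢(ℝ, ℂ),
        ‖-(bessel (-2) (TemperedDistribution.derivCLM ℂ
          (toDist f + (1 / 2 : ℂ) • sqDist f)) (besselS (s + η) φ))‖ ≤
          (‖F‖ + C * ‖F‖ ^ 2) * ‖φ.toLp 2 volume‖ := by
  obtain ⟨C, hC, h⟩ := exists_norm_sqDist_le (s := s) (r := s + η - 1) hs (by linarith)
    (by linarith)
  refine ⟨C, hC, fun f F hF φ => ?_⟩
  set φ' := SchwartzMap.fourierMultiplierCLM ℂ derivSymbol φ with hφ'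
  have hφ'n : ‖φ'.toLp 2 volume‖ ≤ ‖φ.toLp 2 volume‖ :=
    norm_fourierMultiplier_le hasTemperateGrowth_derivSymbol norm_derivSymbol_le_one φ
  have e1 : bessel (-2) (TemperedDistribution.derivCLM ℂ (toDist f + (1 / 2 : ℂ) • sqDist f))
      (besselS (s + η) φ) = -(toDist f (besselS (s + η - 1) φ') +
        (1 / 2 : ℂ) * sqDist f (besselS (s + η - 1) φ')) := by
    rw [bessel_apply, TemperedDistribution.derivCLM_apply_apply, besselS_besselS, derivCLM_besselS,
      map_neg, show -2 + (s + η) + 1 = s + η - 1 by ring]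
    rfl
  have e2 : toDist f (besselS (s + η - 1) φ') = (F : 𝓢'(ℝ, ℂ)) (besselS (η - 1) φ') := by
    rw [← hF, bessel_apply, besselS_besselS, add_sub_assoc]
  have b1 : ‖toDist f (besselS (s + η - 1) φ')‖ ≤ ‖F‖ * ‖φ.toLp 2 volume‖ := by
    rw [e2]
    refine (norm_toTemperedDistribution_apply_le F _).trans ?_
    gcongr
    exact (norm_besselS_le (by linarith) φ').trans hφ'n
  have b2 : ‖(1 / 2 : ℂ) * sqDist f (besselS (s + η - 1) φ')‖ ≤
      C * ‖F‖ ^ 2 * ‖φ.toLp 2 volume‖ := by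
    calc _ ≤ 1 * ‖sqDist f (besselS (s + η - 1) φ')‖ := by
          rw [norm_mul]; gcongr; norm_num
      _ ≤ C * (‖F‖ ^ 2 * ‖φ'.toLp 2 volume‖) := by rw [one_mul]; exact h f F hF φ'
      _ ≤ C * (‖F‖ ^ 2 * ‖φ.toLp 2 volume‖) := by gcongr
      _ = _ := by ring
  rw [e1, neg_neg, add_mul]
  exact (norm_add_le _ _).trans (add_le_add b1 b2)

/-- The increments `u(t) - u(t')` lie in `H^{s+η}`, with norm at most `M |t - t'|` on bounded time
intervals. Only the `H^s` bound of `u` on such an interval enters the constant `M`. -/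
lemma exists_bessel_sub_eq {s η : ℝ} (hs : 0 ≤ s) (hη : η ≤ 1) (hsη : η < s + 1 / 2)
    {u₀ : Lp ℝ 2 (volume : Measure ℝ)} {u : ℝ → Lp ℝ 2 (volume : Measure ℝ)}
    (hu : ContinuousIntoHs s u) (hsol : SolvesBBM u₀ u) (R : ℝ) :
    ∃ M : ℝ, 0 ≤ M ∧ ∀ t ∈ Set.Icc (-R) R, ∀ t' ∈ Set.Icc (-R) R,
      ∃ g : Lp ℂ 2 (volume : Measure ℝ),
        bessel (s + η) (toDist (u t - u t')) = (g : 𝓢'(ℝ, ℂ)) ∧ ‖g‖ ≤ M * |t - t'| := by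
  obtain ⟨C, hC, hvec⟩ := exists_norm_vectorField_le hs hη hsη
  choose F hF using hu.1
  have hFsub (t t' : ℝ) : bessel s (toDist (u t - u t')) =
      ((F t - F t' : Lp ℂ 2 (volume : Measure ℝ)) : 𝓢'(ℝ, ℂ)) := by
    rw [toDist_sub, map_sub, hF, hF]
    exact (map_sub (Lp.toTemperedDistributionCLM ℂ volume 2) _ _).symm
  have hFc : Continuous F := by
    refine continuous_iff_continuousAt.2 fun t₀ => ?_
    have := hu.2 t₀
    simp_rw [hsNorm_eq (hFsub _ t₀)] at this
    rw [ContinuousAt, tendsto_iff_norm_sub_tendsto_zero]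
    simpa [Function.comp_def] using (ENNReal.tendsto_toReal ENNReal.zero_ne_top).comp this
  obtain ⟨B, hB⟩ := isCompact_Icc.exists_bound_of_continuousOn
    (f := F) (s := Set.Icc (-R) R) hFc.continuousOn
  set N := max B 0
  refine ⟨N + C * N ^ 2, by positivity, fun t ht t' ht' => ?_⟩
  refine exists_eq_toTemperedDistribution _ (by positivity) fun φ => ?_
  -- the equation tested against `J^{s+η} φ`, integrated in time by the mean value inequality
  have hmv := Convex.norm_image_sub_le_of_norm_hasDerivWithin_le (s := Set.Icc (-R) R)
    (f := fun τ => toDist (u τ) (besselS (s + η) φ))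
    (C := (N + C * N ^ 2) * ‖φ.toLp 2 volume‖)
    (fun τ _ => (hsol.equation τ (besselS (s + η) φ)).hasDerivWithinAt)
    (fun τ hτ => by
      have : ‖F τ‖ ≤ N := (hB τ hτ).trans (le_max_left _ _)
      exact (hvec (u τ) (F τ) (hF τ) φ).trans (by gcongr))
    (convex_Icc _ _) ht' ht
  rw [bessel_apply, toDist_sub]
  refine hmv.trans_eq ?_
  rw [Real.norm_eq_abs]
  ring

lemma memHs_sub {r : ℝ} {f g : Lp ℝ 2 (volume : Measure ℝ)} (hf : MemHs r f) (hg : MemHs r g) :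
    MemHs r (f - g) := by
  obtain ⟨F, hF⟩ := hf
  obtain ⟨G, hG⟩ := hg
  refine ⟨F - G, ?_⟩
  rw [toDist_sub, map_sub, hF, hG]
  exact (map_sub (Lp.toTemperedDistributionCLM ℂ volume 2) _ _).symm

/-- Functions that differ by an element of `H^r(ℝ)` are in `H^r(Ω)` simultaneously. -/
lemma memHsOn_of_memHs_sub {r : ℝ} {Ω : Set ℝ} {f g : Lp ℝ 2 (volume : Measure ℝ)}
    (h : MemHs r (f - g)) (hf : MemHsOn r Ω f) : MemHsOn r Ω g := by
  obtain ⟨F, hF, hFf⟩ := hf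
  refine ⟨F - (f - g), memHs_sub hF h, ?_⟩
  filter_upwards [hFf, ae_restrict_of_ae (Lp.coeFn_sub F (f - g)),
    ae_restrict_of_ae (Lp.coeFn_sub f g)] with x h1 h2 h3
  rw [h2, Pi.sub_apply, h3, Pi.sub_apply, h1, sub_sub_cancel]

/-- Regularity of order `s + η` on `Ω` is neither gained nor lost in time, because the increments
of a solution have this regularity on the whole line. -/
lemma memHsOn_propagation {s η : ℝ} (hs : 0 ≤ s) (hη : η ≤ 1) (hsη : η < s + 1 / 2) (Ω : Set ℝ)
    {u₀ : Lp ℝ 2 (volume : Measure ℝ)} {u : ℝ → Lp ℝ 2 (volume : Measure ℝ)}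
    (hu : ContinuousIntoHs s u) (hsol : SolvesBBM u₀ u) :
    (MemHsOn (s + η) Ω u₀ → ContinuousIntoHsOn (s + η) Ω (fun t => u t)) ∧
      (¬ MemHsOn (s + η) Ω u₀ → ∀ t, ¬ MemHsOn (s + η) Ω (u t)) := by
  have key (t t' : ℝ) : MemHs (s + η) (u t - u t') := by
    obtain ⟨M, -, h⟩ := exists_bessel_sub_eq hs hη hsη hu hsol (max |t| |t'|)
    obtain ⟨g, hg, -⟩ := h t (abs_le.1 (le_max_left _ _)) t' (abs_le.1 (le_max_right _ _))
    exact ⟨g, hg⟩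
  refine ⟨fun h0 => ⟨fun t => ?_, fun t₀ => ?_⟩, fun h0 t ht => h0 ?_⟩
  · rw [← hsol.initial] at h0
    exact memHsOn_of_memHs_sub (key 0 t) h0
  · obtain ⟨M, hM, h⟩ := exists_bessel_sub_eq hs hη hsη hu hsol (|t₀| + 1)
    have hlim : Tendsto (fun t => ENNReal.ofReal (M * |t - t₀|)) (𝓝 t₀) (𝓝 0) := by
      have : Continuous fun t => ENNReal.ofReal (M * |t - t₀|) :=
        ENNReal.continuous_ofReal.comp (by fun_prop)
      simpa using this.tendsto t₀
    refine tendsto_of_tendsto_of_tendsto_of_le_of_le' tendsto_const_nhds hlim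
      (.of_forall fun _ => zero_le) ?_
    filter_upwards [Metric.ball_mem_nhds t₀ one_pos] with t ht
    have ht1 : |t| ≤ |t₀| + 1 := by
      have := abs_sub_abs_le_abs_sub t t₀
      rw [Metric.mem_ball, Real.dist_eq] at ht
      linarith
    obtain ⟨g, hg, hgM⟩ := h t (abs_le.1 ht1) t₀ (abs_le.1 (by linarith))
    calc hsOnNorm (s + η) Ω (u t - u t₀) ≤ hsNorm (s + η) (u t - u t₀) :=
          iInf₂_le (u t - u t₀) (ae_restrict_of_ae (Lp.coeFn_sub (u t) (u t₀)))
      _ = ‖g‖ₑ := hsNorm_eq hg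
      _ ≤ ENNReal.ofReal (M * |t - t₀|) := by
          rw [← ofReal_norm]
          exact ENNReal.ofReal_le_ofReal hgM
  · rw [← hsol.initial]
    exact memHsOn_of_memHs_sub (key t 0) ht

end BBM
end

theorem mainTheorem10
    (s : ℝ) (hs : 0 ≤ s) (Ω : Set ℝ) (hΩ : IsOpen Ω)
    (u₀ : MeasureTheory.Lp ℝ 2 (MeasureTheory.volume : MeasureTheory.Measure ℝ))
    (hu₀ : BBM.MemHs s u₀)
    (u : ℝ → MeasureTheory.Lp ℝ 2 (MeasureTheory.volume : MeasureTheory.Measure ℝ))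
    (hu : BBM.ContinuousIntoHs s u) (hsol : BBM.SolvesBBM u₀ u) :
    (s ≤ 1 / 2 → ∀ η ∈ Set.Ioo (0 : ℝ) (s + 1 / 2),
      (BBM.MemHsOn (s + η) Ω u₀ → BBM.ContinuousIntoHsOn (s + η) Ω (fun t => u t)) ∧
      (¬ BBM.MemHsOn (s + η) Ω u₀ → ∀ t, ¬ BBM.MemHsOn (s + η) Ω (u t))) ∧
    (1 / 2 < s → ∀ η ∈ Set.Ioc (0 : ℝ) 1,
      (BBM.MemHsOn (s + η) Ω u₀ → BBM.ContinuousIntoHsOn (s + η) Ω (fun t => u t)) ∧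
      (¬ BBM.MemHsOn (s + η) Ω u₀ → ∀ t, ¬ BBM.MemHsOn (s + η) Ω (u t))) :=
  ⟨fun hs' _ hη => BBM.memHsOn_propagation hs (by linarith [hη.2]) hη.2 Ω hu hsol,
    fun hs' _ hη => BBM.memHsOn_propagation hs hη.2 (by linarith [hη.2]) Ω hu hsol⟩
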